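/- Let $\mathbb X\subset\mathbb R^n$ be a Borel set, let $\mathbb U$ be a finite nonempty (hence compact) action set with the discrete topology, let $\mathcal T(dx_1\mid x,u)$ be a stochastic kernel from $\mathbb X\times\mathbb U$ to $\mathbb X$, let $c:\mathbb X\times\mathbb U\to[0,\infty)$ be a bounded continuous cost function with sup-norm $\|c\|_\infty$, and let $0<\beta<1$. An admissible policy $\gamma=(\gamma_t)_{t\ge0}$ is a sequence of measurable maps with $U_t=\gamma_t(X_0,\dots,X_t,U_0,\dots,U_{t-1})$; it is stationary if $U_t=f(X_t)$ for all $t$ with one measurable $f:\mathbb X\to\mathbb U$. Let $\Gamma$ and $\Gamma_s$ be the sets of admissible and of stationary policies, let $E^\gamma_{x_0}$ be the expectation for the controlled chain started at $X_0=x_0$, and put $$J^*_\beta(x_0)=\inf_{\gamma\in\Gamma}E^{\gamma}_{x_0}\Big[\sum_{t=0}^\infty\beta^t c(X_t,U_t)\Big].$$ Assume that $\mathcal T$ is weak Feller (i.e. $(x,u)\mapsto\int g(x_1)\,\mathcal T(dx_1\mid x,u)$ is continuous for every bounded continuous $g$), and that there are constants $\alpha_c,\alpha_T>0$ such that for all $x,x'\in\mathbb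 X$, $u\in\mathbb U$, $$|c(x,u)-c(x',u)|\le\alpha_c\|x-x'\|_1,\qquad \|\mathcal T(\cdot\mid x,u)-\mathcal T(\cdot\mid x',u)\|_{TV}\le\alpha_T\|x-x'\|_1,$$ where $\|\mu-\nu\|_{TV}=\sup_B|\mu(B)-\nu(B)|$ (so the result holds a fortiori if $\|\cdot\|_{TV}$ is normalized to be twice as large). Let $B_1,\dots,B_M$ be a partition of $\mathbb X$ into Borel sets, let $y_i\in B_i$ be representative states, $\mathbb Y=\{y_1,\dots,y_M\}$, and $q(x)=y_i$ for $x\in B_i$. Let $\pi$ be a probability measure on $\mathbb X$ with $\pi(B_i)>0$ for all $i$, and let $\hat\pi_{y_i}(A)=\pi(A\cap B_i)/\pi(B_i)$. The finite model is the Markov decision process on $\mathbb Y$ with action set $\mathbb U$, cost $C^*(y_i,u)=\int_{B_i}c(x,u)\,\hat\pi_{y_i}(dx)$ and transition probabilities $P^*(y_j\mid y_i,u)=\int_{B_i}\mathcal T(B_j\mid x,u)\,\hat\pi_{y_i}(dx)$. Let $\hat J_\beta:\mathbb Y\to\mathbb R$ be its optimal $\beta$-discounted value function (infimum over the admissible policies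 of the finite model), extended to $\mathbb X$ by $\hat J_\beta(x)=\hat J_\beta(q(x))$. Let $$L(x)=\int_{B_i}\|x-x'\|_1\,\hat\pi_{y_i}(dx')\in[0,\infty],\qquad x\in B_i.$$ Then: (a) $\hat J_\beta$ is the unique function on $\mathbb Y$ that satisfies $\hat J_\beta(y)=\inf_{u\in\mathbb U}\{C^*(y,u)+\beta\sum_{z\in\mathbb Y}\hat J_\beta(z)P^*(z\mid y,u)\}$ for all $y\in\mathbb Y$. (b) There is a measurable $f:\mathbb X\to\mathbb U$ such that for every $x\in\mathbb X$ the action $f(x)$ attains $\sup_{u\in\mathbb U}\int|\hat J_\beta(x_1)-J^*_\beta(x_1)|\,\mathcal T(dx_1\mid x,u)$. (c) For every such $f$, with $\gamma_s=(f,f,\dots)$ the corresponding stationary policy, and for every $x_0\in\mathbb X$, $$|\hat J_\beta(x_0)-J^*_\beta(x_0)|\le\Big(\alpha_c+\frac{\beta\alpha_T\|c\|_\infty}{1-\beta}\Big)\,E^{\gamma_s}_{x_0}\Big[\sum_{t=0}^\infty\beta^tL(X_t)\Big].$$ (d) In particular, for every $x_0\in\mathbb X$, $$|\hat J_\beta(x_0)-J^*_\beta(x_0)|\le\Big(\alpha_c+\frac{\beta\alpha_T\|c\|_\infty}{1-\beta}\Big)\,\sup_{\gamma_s\in\Gamma_s}E^{\gamma_s}_{x_0}\Big[\sum_{t=0}^\infty\beta^tL(X_t)\Big].$$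 The right-hand sides of (c) and (d) may be $+\infty$. -/

import Mathlib

open MeasureTheory ProbabilityTheory
open scoped ENNReal BoundedContinuousFunction

noncomputable section

namespace QuantizedMDP

/-! ### Controlled Markov chains with discounted cost -/

section General

variable {S A : Type*} [MeasurableSpace S] [MeasurableSpace A]

/-- An admissible policy: at time `t` the action is a measurable function of the information
`(x_0, …, x_t, u_0, …, u_{t-1})`. -/
structure AdmissiblePolicy (S A : Type*) [MeasurableSpace S] [MeasurableSpace A] where
  act : (t : ℕ) → (Fin (t + 1) → S) × (Fin t → A) → A
  measurable_act : ∀ t, Measurable (act t)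

/-- The stationary policy `(f, f, f, …)`, where the control function `f` acts on the current
state. -/
def AdmissiblePolicy.stationary (f : S → A) (hf : Measurable f) : AdmissiblePolicy S A where
  act := fun t I => f (I.1 (Fin.last t))
  measurable_act := fun _ => hf.comp ((measurable_pi_apply _).comp measurable_fst)

/-- The information vector at time `t + 1`, obtained from the state-action pairs up to time `t`
and the new state. -/
def nextInfo (t : ℕ) (p : ((_ : Finset.Iic t) → S × A) × S) :
    (Fin (t + 1 + 1) → S) × (Fin (t + 1) → A) :=
  (Fin.snoc (α := fun _ => S)
      (fun i : Fin (t + 1) => (p.1 ⟨i, Finset.mem_Iic.2 (Nat.lt_succ_iff.1 i.2)⟩).1) p.2,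
    fun i => (p.1 ⟨i, Finset.mem_Iic.2 (Nat.lt_succ_iff.1 i.2)⟩).2)

lemma measurable_nextInfo (t : ℕ) : Measurable (nextInfo (S := S) (A := A) t) := by
  refine Measurable.prodMk (measurable_pi_iff.2 fun i => ?_) (measurable_pi_iff.2 fun i => ?_)
  · refine Fin.lastCases ?_ (fun j => ?_) i
    · simpa using measurable_snd
    · simpa using ((measurable_pi_apply _).comp measurable_fst).fst
  · exact ((measurable_pi_apply _).comp measurable_fst).snd

/-- Conditional law of `(X_{t+1}, U_{t+1})` given `(X_0, U_0, …, X_t, U_t)`: the state `X_{t+1}`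
has law `T(· | X_t, U_t)`, and `U_{t+1}` is the policy evaluated at the information vector. -/
def stepKernel (T : Kernel (S × A) S) (γ : AdmissiblePolicy S A) (t : ℕ) :
    Kernel ((_ : Finset.Iic t) → S × A) (S × A) :=
  (Kernel.id ×ₖ T.comap
      (fun h : ((_ : Finset.Iic t) → S × A) => h ⟨t, Finset.mem_Iic.2 le_rfl⟩)
      (measurable_pi_apply _)).map
    (fun p => (p.2, γ.act (t + 1) (nextInfo t p)))

instance (T : Kernel (S × A) S) [IsMarkovKernel T] (γ : AdmissiblePolicy S A) (t : ℕ) :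
    IsMarkovKernel (stepKernel T γ t) :=
  Kernel.IsMarkovKernel.map _
    (measurable_snd.prodMk ((γ.measurable_act _).comp (measurable_nextInfo t)))

/-- The law of the state-action process `(X_t, U_t)_{t ≥ 0}` under the policy `γ`, started at
`X_0 = x₀` (Ionescu-Tulcea). -/
def pathLaw (T : Kernel (S × A) S) [IsMarkovKernel T] (γ : AdmissiblePolicy S A) (x₀ : S) :
    Measure (ℕ → S × A) :=
  Kernel.traj (X := fun _ => S × A) (stepKernel T γ) 0
    (fun _ => (x₀, γ.act 0 (fun _ => x₀, Fin.elim0)))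

/-- Infinite-horizon discounted expected cost `J_β(x₀, γ)`. -/
def discountedCost (T : Kernel (S × A) S) [IsMarkovKernel T] (c : S × A → ℝ) (β : ℝ)
    (x₀ : S) (γ : AdmissiblePolicy S A) : ℝ :=
  ∫ ω, ∑' t : ℕ, β ^ t * c (ω t) ∂(pathLaw T γ x₀)

/-- The optimal value function `x₀ ↦ inf_γ J_β(x₀, γ)` over all admissible policies. -/
def optimalValue (T : Kernel (S × A) S) [IsMarkovKernel T] (c : S × A → ℝ) (β : ℝ)
    (x₀ : S) : ℝ :=
  ⨅ γ : AdmissiblePolicy S A, discountedCost T c β x₀ γ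

/-- `E_{x₀}^γ [∑_t β^t ℓ(X_t)]` for a `[0, ∞]`-valued function `ℓ` of the state. -/
def expectedDiscounted (T : Kernel (S × A) S) [IsMarkovKernel T] (β : ℝ) (ℓ : S → ℝ≥0∞)
    (γ : AdmissiblePolicy S A) (x₀ : S) : ℝ≥0∞ :=
  ∫⁻ ω, ∑' t : ℕ, ENNReal.ofReal (β ^ t) * ℓ (ω t).1 ∂(pathLaw T γ x₀)

/-- Total variation distance `sup_B |μ(B) - ν(B)|` of two finite measures. With the other usual
normalization (twice this number) a Lipschitz bound is a stronger requirement. -/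
def tvDist (μ ν : Measure S) : ℝ :=
  ⨆ B : {B : Set S // MeasurableSet B}, |μ.real B - ν.real B|

/-- The kernel is weak Feller. -/
def WeakFeller [TopologicalSpace S] [TopologicalSpace A] (T : Kernel (S × A) S) : Prop :=
  ∀ g : S →ᵇ ℝ, Continuous fun p : S × A => ∫ x, g x ∂(T p)

end General

/-- The `ℓ₁` norm on `ℝⁿ`. -/
def l1norm {n : ℕ} (v : Fin n → ℝ) : ℝ := ∑ k, |v k|

/-! ### Quantization and the finite model -/

/-- A partition of the state space into `M` measurable bins `B_i` with representative states
`y_i ∈ B_i`, and a probability measure `π` charging every bin. -/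
structure Quantization (S : Type*) [MeasurableSpace S] (M : ℕ) where
  bin : Fin M → Set S
  measurableSet_bin : ∀ i, MeasurableSet (bin i)
  disjoint_bin : ∀ i j, i ≠ j → Disjoint (bin i) (bin j)
  iUnion_bin : ⋃ i, bin i = Set.univ
  rep : Fin M → S
  rep_mem : ∀ i, rep i ∈ bin i
  weight : Measure S
  isProbabilityMeasure_weight : IsProbabilityMeasure weight
  weight_pos : ∀ i, 0 < weight (bin i)

namespace Quantization

variable {S A : Type*} [MeasurableSpace S] [MeasurableSpace A] {M : ℕ} (Q : Quantization S M)

lemma exists_mem_bin (x : S) : ∃ i, x ∈ Q.bin i :=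
  Set.mem_iUnion.1 (Q.iUnion_bin ▸ Set.mem_univ x)

/-- The index `i` of the bin `B_i` that contains `x`. The quantizer is `x ↦ rep (index x)`; the
state `y_i` of the finite model is identified with its index `i`. -/
def index (x : S) : Fin M := (Q.exists_mem_bin x).choose

/-- The normalized measure `π̂_{y_i} = π(· ∩ B_i) / π(B_i)`. -/
def binMeasure (i : Fin M) : Measure S := Q.weight[|Q.bin i]

instance (i : Fin M) : IsProbabilityMeasure (Q.binMeasure i) :=
  have := Q.isProbabilityMeasure_weight
  cond_isProbabilityMeasure (Q.weight_pos i).ne'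

/-- The cost `C*(y_i, u) = ∫_{B_i} c(x, u) π̂_{y_i}(dx)` of the finite model. -/
def finiteCost (c : S × A → ℝ) (p : Fin M × A) : ℝ :=
  ∫ x in Q.bin p.1, c (x, p.2) ∂(Q.binMeasure p.1)

/-- The transition probability `P*(y_j | y_i, u) = ∫_{B_i} T(B_j | x, u) π̂_{y_i}(dx)`. -/
def finiteProb (T : Kernel (S × A) S) (p : Fin M × A) (j : Fin M) : ℝ≥0∞ :=
  ∫⁻ x in Q.bin p.1, T (x, p.2) (Q.bin j) ∂(Q.binMeasure p.1)

/-- `P*` as a stochastic kernel. -/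
def finiteKernel [Finite A] [DiscreteMeasurableSpace A] (T : Kernel (S × A) S) :
    Kernel (Fin M × A) (Fin M) where
  toFun p := ∑ j, Q.finiteProb T p j • Measure.dirac j
  measurable' := Measurable.of_discrete

instance [Finite A] [DiscreteMeasurableSpace A] (T : Kernel (S × A) S) [IsMarkovKernel T] :
    IsMarkovKernel (Q.finiteKernel T) := by
  refine ⟨fun p => ⟨?_⟩⟩
  have h1 : ∀ x, ∑ j, T (x, p.2) (Q.bin j) = 1 := fun x => by
    rw [← tsum_fintype (L := .unconditional _),
      ← measure_iUnion (fun i j h => Q.disjoint_bin i j h) Q.measurableSet_bin,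
      Q.iUnion_bin, measure_univ]
  have hb : Q.binMeasure p.1 (Q.bin p.1) = 1 := by
    have := Q.isProbabilityMeasure_weight
    exact cond_apply_self (Q.weight_pos p.1).ne' (measure_ne_top _ _)
  change (∑ j, Q.finiteProb T p j • Measure.dirac j : Measure (Fin M)) Set.univ = 1
  simp only [Measure.coe_finsetSum, Finset.sum_apply, Measure.smul_apply, measure_univ,
    smul_eq_mul, mul_one, finiteProb]
  rw [← lintegral_finsetSum]
  · simp [h1, hb]
  · exact fun j _ => (Kernel.measurable_coe T (Q.measurableSet_bin j)).comp
      (measurable_id.prodMk measurable_const)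

/-- The dynamic programming equation of the finite model:
`v(y) = inf_u { C*(y, u) + β ∑_z v(z) P*(z | y, u) }`. -/
def SolvesDPE (T : Kernel (S × A) S) (c : S × A → ℝ) (β : ℝ) (v : Fin M → ℝ) : Prop :=
  ∀ i, v i = ⨅ u : A, (Q.finiteCost c (i, u) + β * ∑ j, v j * (Q.finiteProb T (i, u) j).toReal)

/-- The value function of the finite model, a function of (the index of) the finite state. -/
def finiteValue [Finite A] [DiscreteMeasurableSpace A] (T : Kernel (S × A) S) [IsMarkovKernel T]
    (c : S × A → ℝ) (β : ℝ) : Fin M → ℝ :=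
  optimalValue (Q.finiteKernel T) (Q.finiteCost c) β

/-- The value function of the finite model extended to the whole state space by
`Ĵ_β(x) = Ĵ_β(q(x))`. -/
def approxValue [Finite A] [DiscreteMeasurableSpace A] (T : Kernel (S × A) S) [IsMarkovKernel T]
    (c : S × A → ℝ) (β : ℝ) (x : S) : ℝ :=
  Q.finiteValue T c β (Q.index x)

/-- The control function `f` attains, at every state `x`, the supremum
`sup_u ∫ |Ĵ_β(x₁) - J*_β(x₁)| T(dx₁ | x, u)`. -/
def AttainsSup [Finite A] [DiscreteMeasurableSpace A] (T : Kernel (S × A) S) [IsMarkovKernel T]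
    (c : S × A → ℝ) (β : ℝ) (f : S → A) : Prop :=
  ∀ x, ∫⁻ z, ENNReal.ofReal |Q.approxValue T c β z - optimalValue T c β z| ∂(T (x, f x)) =
    ⨆ u : A, ∫⁻ z, ENNReal.ofReal |Q.approxValue T c β z - optimalValue T c β z| ∂(T (x, u))

/-- The loss `L(x) = ∫_{B_i} ‖x - x'‖₁ π̂_{y_i}(dx')` for `x ∈ B_i`, with values in `[0, ∞]`. -/
def loss {n : ℕ} {X : Set (Fin n → ℝ)} (Q : Quantization X M) (x : X) : ℝ≥0∞ :=
  ∫⁻ x' in Q.bin (Q.index x), ENNReal.ofReal (l1norm (x.1 - x'.1)) ∂(Q.binMeasure (Q.index x))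

end Quantization

end QuantizedMDP

end

open QuantizedMDP

namespace QuantizedMDP

section General

variable {S A : Type*} [MeasurableSpace S] [MeasurableSpace A]

/-! ### Finite infima and measurable selection -/

/-! Write `J` for the optimal value, `v` for the value of the finite model and `D = |v ∘ q - J|` for
the error.

Both values solve dynamic programming equations. Value iteration from `0` in `ℝ≥0∞` increases to a
measurable, bounded fixed point. Unrolling the fixed-point equation along the chain shows that no
admissible policy, history-dependent or not, does better, and that a measurable minimizing control
attains it (`exists_bellman_fixedPoint`, `optimalValue_spec`). This applies to the original model
and to the finite one; uniqueness for the latter is a contraction argument.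

Read on `X`, the right side of the finite equation is the average over the bin of `c(x', u) + β ∫ v
∘ q dT(x', u)`. The two infima can be compared at one common action `u`. Inserting `c(x, u) + β ∫ v
∘ q dT(x, u)` splits the error into a bin average, controlled by the Lipschitz hypotheses and hence
by `L(x)`, and the propagated term `β ∫ D dT(x, u)`. As `u` is not explicit, it is replaced by the
worst action. Thus `D` satisfies `D ≤ C L + β sup_u ∫ D dT(·, u)` (`ofReal_abs_approxValue_sub_le`),
which under the maximizing control `f` becomes a recursion along the controlled chain. Iterating it
(`le_lintegral_tsum_of_subsolution`) gives the bound, because `D` is bounded and `β ^ N` kills the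
remainder. -/

lemma exists_measurable_forall_le [Finite A] [Nonempty A] [DiscreteMeasurableSpace A]
    {α : Type*} [TopologicalSpace α] [LinearOrder α] [OrderClosedTopology α]
    [SecondCountableTopology α] [MeasurableSpace α] [OpensMeasurableSpace α]
    {g : S × A → α} (hg : Measurable g) :
    ∃ f : S → A, Measurable f ∧ ∀ x u, g (x, u) ≤ g (x, f x) := by
  classical
  have := Fintype.ofFinite A
  -- Actions are added one at a time; the selector switches to the new action on the measurable set
  -- where that is at least as good.
  suffices H : ∀ s : Finset A, s.Nonempty →
      ∃ f : S → A, Measurable f ∧ ∀ x, ∀ u ∈ s, g (x, u) ≤ g (x, f x) by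
    obtain ⟨f, hf, h⟩ := H Finset.univ Finset.univ_nonempty
    exact ⟨f, hf, fun x u => h x u (Finset.mem_univ u)⟩
  intro s hs
  induction hs using Finset.Nonempty.cons_induction with
  | singleton a => exact ⟨fun _ => a, measurable_const, by simp⟩
  | cons a s _ _ ih =>
    obtain ⟨f, hf, h⟩ := ih
    have hm : MeasurableSet {x | g (x, f x) ≤ g (x, a)} :=
      measurableSet_le (hg.comp (measurable_id.prodMk hf))
        (hg.comp (measurable_id.prodMk measurable_const))
    refine ⟨fun x => if g (x, f x) ≤ g (x, a) then a else f x,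
      Measurable.ite hm measurable_const hf, fun x u hu => ?_⟩
    rcases Finset.mem_cons.1 hu with rfl | hu
    · by_cases hx : g (x, f x) ≤ g (x, u)
      · simp [hx]
      · simpa [hx] using (not_le.1 hx).le
    · by_cases hx : g (x, f x) ≤ g (x, a)
      · simpa [hx] using (h x u hu).trans hx
      · simpa [hx] using h x u hu

lemma exists_measurable_eq_iSup [Finite A] [Nonempty A] [DiscreteMeasurableSpace A]
    {g : S × A → ℝ≥0∞} (hg : Measurable g) :
    ∃ f : S → A, Measurable f ∧ ∀ x, g (x, f x) = ⨆ u, g (x, u) := by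
  obtain ⟨f, hf, h⟩ := exists_measurable_forall_le hg
  exact ⟨f, hf, fun x => le_antisymm (le_iSup (fun u => g (x, u)) (f x)) (iSup_le (h x))⟩

lemma exists_measurable_eq_iInf [Finite A] [Nonempty A] [DiscreteMeasurableSpace A]
    {g : S × A → ℝ≥0∞} (hg : Measurable g) :
    ∃ f : S → A, Measurable f ∧ ∀ x, g (x, f x) = ⨅ u, g (x, u) := by
  obtain ⟨f, hf, h⟩ := exists_measurable_forall_le (α := ℝ≥0∞ᵒᵈ)
    (g := fun p => OrderDual.toDual (g p)) hg
  exact ⟨f, hf, fun x => le_antisymm (le_iInf (h x)) (iInf_le (fun u => g (x, u)) (f x))⟩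

/-- The minimizer belonging to the smaller infimum works: evaluating the other family there can only
widen the gap. A single common index is what lets two Bellman equations be compared action by
action. -/
lemma exists_abs_iInf_sub_iInf_le {ι : Type*} [Finite ι] [Nonempty ι] (a b : ι → ℝ) :
    ∃ i, |(⨅ i, a i) - ⨅ i, b i| ≤ |a i - b i| := by
  obtain ⟨i, hi⟩ := exists_eq_ciInf_of_finite (f := a)
  obtain ⟨j, hj⟩ := exists_eq_ciInf_of_finite (f := b)
  have h1 : a i ≤ a j := hi ▸ ciInf_le (Set.finite_range a).bddBelow j
  have h2 : b j ≤ b i := hj ▸ ciInf_le (Set.finite_range b).bddBelow i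
  rw [← hi, ← hj]
  rcases le_total (a i) (b j) with h | h
  · exact ⟨i, by rw [abs_of_nonpos (by linarith), abs_of_nonpos (by linarith)]; linarith⟩
  · exact ⟨j, by rw [abs_of_nonneg (by linarith), abs_of_nonneg (by linarith)]; linarith⟩

section Bellman

/-! ### Value iteration -/

variable (T : Kernel (S × A) S) {v : S → ℝ≥0∞} {l : S × A → ℝ≥0∞} {b : ℝ≥0∞}

variable (b l) in
/-- The dynamic programming operator `v ↦ (x ↦ inf_u { l(x, u) + b ∫ v dT(x, u) })`. -/
noncomputable def bellman (v : S → ℝ≥0∞) (x : S) : ℝ≥0∞ := ⨅ u : A, (l (x, u) + b * ∫⁻ s, v s ∂(T (x, u)))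

variable (b l) in
/-- Value iteration started at `0`. -/
noncomputable def valueIter (n : ℕ) : S → ℝ≥0∞ := (bellman T l b)^[n] 0

lemma valueIter_succ (n : ℕ) : valueIter T l b (n + 1) = bellman T l b (valueIter T l b n) :=
  Function.iterate_succ_apply' _ _ _

lemma monotone_bellman : Monotone (bellman T l b) := fun v w h x =>
  iInf_mono fun u => by gcongr; exact h _

lemma monotone_valueIter : Monotone (valueIter T l b) :=
  (monotone_bellman T).monotone_iterate_of_le_map (fun _ => zero_le)

lemma measurable_bellman [Finite A] (hl : Measurable l) (hv : Measurable v) :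
    Measurable (bellman T l b v) :=
  Measurable.iInf fun _ => (hl.comp measurable_prodMk_right).add
    ((hv.lintegral_kernel.comp measurable_prodMk_right).const_mul _)

lemma measurable_valueIter [Finite A] (hl : Measurable l) (n : ℕ) :
    Measurable (valueIter T l b n) := by
  induction n with
  | zero => exact measurable_zero
  | succ n ih => rw [valueIter_succ]; exact measurable_bellman T hl ih

/-- The Bellman operator has a measurable fixed point, which is bounded by every constant that
is a supersolution. -/
lemma exists_bellman_fixedPoint [IsMarkovKernel T] [Finite A] [Nonempty A] (hl : Measurable l) {K : ℝ≥0∞}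
    (hK : ∀ p, l p + b * K ≤ K) :
    ∃ v : S → ℝ≥0∞, Measurable v ∧ (∀ x, v x ≤ K) ∧ bellman T l b v = v := by
  have hmono := monotone_valueIter T (l := l) (b := b)
  refine ⟨fun x => ⨆ n, valueIter T l b n x, Measurable.iSup (measurable_valueIter T hl),
    fun x => iSup_le fun n => ?_, funext fun x => ?_⟩
  · induction n generalizing x with
    | zero => exact zero_le
    | succ n ih =>
      rw [valueIter_succ]
      refine (iInf_le _ (Classical.arbitrary A)).trans (le_trans ?_ (hK (x, Classical.arbitrary A)))
      gcongr
      calc _ ≤ ∫⁻ _, K ∂(T (x, Classical.arbitrary A)) := lintegral_mono ih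
        _ = K := by simp
  · have h1 : bellman T l b (fun x => ⨆ n, valueIter T l b n x) x =
        ⨅ u : A, ⨆ n, (l (x, u) + b * ∫⁻ s, valueIter T l b n s ∂(T (x, u))) := by
      refine iInf_congr fun u => ?_
      rw [lintegral_iSup (measurable_valueIter T hl) hmono, ENNReal.mul_iSup, ENNReal.add_iSup]
    -- Finiteness of the action set allows the infimum to commute with an increasing supremum.
    rw [h1, ← iSup_iInf_of_monotone]
    · calc _ = ⨆ n, valueIter T l b (n + 1) x := by simp_rw [valueIter_succ]; rfl
        _ = _ := (show Monotone fun n => valueIter T l b n x from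
            fun _ _ h => hmono h x).iSup_nat_add 1
    · intro u m n hmn
      dsimp only
      gcongr
      exact hmono hmn _

end Bellman

/-! ### One-step laws of the controlled chain -/

instance (T : Kernel (S × A) S) [IsMarkovKernel T] (γ : AdmissiblePolicy S A) (x₀ : S) :
    IsProbabilityMeasure (pathLaw T γ x₀) := by
  unfold pathLaw; infer_instance

variable (T : Kernel (S × A) S) [IsMarkovKernel T]

lemma lintegral_pathLaw_zero (γ : AdmissiblePolicy S A) (x₀ : S) {g : S × A → ℝ≥0∞}
    (hg : Measurable g) :
    ∫⁻ ω, g (ω 0) ∂(pathLaw T γ x₀) = g (x₀, γ.act 0 (fun _ => x₀, Fin.elim0)) := by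
  rw [pathLaw, Kernel.lintegral_traj _ (f := fun ω : ℕ → S × A => g (ω 0))
    (hg.comp (measurable_pi_apply 0))]
  simp [Function.updateFinset]

lemma lintegral_stepKernel (γ : AdmissiblePolicy S A) (t : ℕ)
    (h : (_ : Finset.Iic t) → S × A) {g : S × A → ℝ≥0∞} (hg : Measurable g) :
    ∫⁻ y, g y ∂(stepKernel T γ t h) =
      ∫⁻ s, g (s, γ.act (t + 1) (nextInfo t (h, s)))
        ∂(T (h ⟨t, Finset.mem_Iic.2 le_rfl⟩)) := by
  have hm : Measurable fun p : ((_ : Finset.Iic t) → S × A) × S =>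
      (p.2, γ.act (t + 1) (nextInfo t p)) :=
    measurable_snd.prodMk ((γ.measurable_act _).comp (measurable_nextInfo t))
  rw [stepKernel, Kernel.map_apply _ hm, lintegral_map hg hm,
    Kernel.lintegral_id_prod (f := fun p => g (p.2, γ.act (t + 1) (nextInfo t p))) (hg.comp hm),
    Kernel.comap_apply]

/-- The joint law of the history up to `t` and the next pair is the history law composed with
`stepKernel`. This one-step identity is all that the verification arguments need about the
trajectory measure. -/
lemma lintegral_pathLaw_succ (γ : AdmissiblePolicy S A) (x₀ : S) (t : ℕ) {g : S × A → ℝ≥0∞}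
    (hg : Measurable g) :
    ∫⁻ ω, g (ω (t + 1)) ∂(pathLaw T γ x₀) =
      ∫⁻ ω, ∫⁻ s, g (s, γ.act (t + 1) (nextInfo t (fun i => ω i, s))) ∂(T (ω t))
        ∂(pathLaw T γ x₀) := by
  have h := Kernel.partialTraj_compProd_eq_map_traj (X := fun _ => S × A) (κ := stepKernel T γ)
    (Nat.zero_le t)
    (x₀ := fun _ => (x₀, γ.act 0 (fun _ => x₀, Fin.elim0)))
  have hm : Measurable fun ω : ℕ → S × A => (Preorder.frestrictLe t ω, ω (t + 1)) := by fun_prop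
  have e1 : ∫⁻ ω, g (ω (t + 1)) ∂(pathLaw T γ x₀) = ∫⁻ p, g p.2 ∂((pathLaw T γ x₀).map
      fun ω : ℕ → S × A => (Preorder.frestrictLe (π := fun _ => S × A) t ω, ω (t + 1))) := by
    rw [lintegral_map (by fun_prop) hm]
  rw [e1, pathLaw, ← h, Measure.lintegral_compProd (by fun_prop),
    ← Kernel.traj_map_frestrictLe_apply, lintegral_map _ (by fun_prop)]
  · refine lintegral_congr fun ω => ?_
    rw [lintegral_stepKernel T γ t _ hg]
    rfl
  · exact hg.lintegral_kernel

lemma lintegral_pathLaw_succ_fst (γ : AdmissiblePolicy S A) (x₀ : S) (t : ℕ) {v : S → ℝ≥0∞}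
    (hv : Measurable v) :
    ∫⁻ ω, v (ω (t + 1)).1 ∂(pathLaw T γ x₀) =
      ∫⁻ ω, ∫⁻ s, v s ∂(T (ω t)) ∂(pathLaw T γ x₀) :=
  lintegral_pathLaw_succ T γ x₀ t (g := fun p => v p.1) (hv.comp measurable_fst)

/-- Paths carry states and actions separately, so the feedback relation holds only almost surely:
the expected indicator of its failure is zero. -/
lemma stationary_ae_eq [Countable A] [DiscreteMeasurableSpace A] {f : S → A} (hf : Measurable f)
    (x₀ : S) (t : ℕ) :
    ∀ᵐ ω ∂(pathLaw T (AdmissiblePolicy.stationary f hf) x₀), (ω t).2 = f (ω t).1 := by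
  have hs : MeasurableSet {p : S × A | p.2 = f p.1}ᶜ := by
    have : Measurable fun p : S × A => (p.2, f p.1) :=
      measurable_snd.prodMk (hf.comp measurable_fst)
    exact (this (MeasurableSet.of_discrete (s := Set.diagonal A))).compl
  have hg := measurable_one.indicator (f := (1 : S × A → ℝ≥0∞)) hs
  have hgt : Measurable fun ω : ℕ → S × A =>
      ({p : S × A | p.2 = f p.1}ᶜ).indicator (1 : S × A → ℝ≥0∞) (ω t) :=
    hg.comp (measurable_pi_apply t)
  have key : ∫⁻ ω, ({p : S × A | p.2 = f p.1}ᶜ).indicator (1 : S × A → ℝ≥0∞) (ω t)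
      ∂(pathLaw T (AdmissiblePolicy.stationary f hf) x₀) = 0 := by
    cases t with
    | zero =>
      rw [lintegral_pathLaw_zero T _ x₀ hg]
      simp [AdmissiblePolicy.stationary]
    | succ t =>
      rw [lintegral_pathLaw_succ T _ x₀ t hg]
      simp [AdmissiblePolicy.stationary, nextInfo]
  rw [lintegral_eq_zero_iff hgt] at key
  filter_upwards [key] with ω hω
  by_contra hne
  simp [hne] at hω

/-! ### Verification of sub- and supersolutions -/

variable {v : S → ℝ≥0∞} {l : S × A → ℝ≥0∞} {b : ℝ≥0∞}

/-- Unrolling `N` steps leaves a remainder at most `b ^ N * K`, which tends to `0`. The inequality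
is required only along the paths of `γ`, and `l` may take the value `∞`, as the loss can. -/
lemma le_lintegral_tsum_of_subsolution (hv : Measurable v) (hl : Measurable l) (hb : b < 1)
    {K : ℝ≥0∞} (hK : K ≠ ∞) (hvK : ∀ x, v x ≤ K) (γ : AdmissiblePolicy S A) (x₀ : S)
    (h : ∀ t, ∀ᵐ ω ∂(pathLaw T γ x₀), v (ω t).1 ≤ l (ω t) + b * ∫⁻ s, v s ∂(T (ω t))) :
    v x₀ ≤ ∫⁻ ω, ∑' t, b ^ t * l (ω t) ∂(pathLaw T γ x₀) := by
  have hlt : ∀ t, Measurable fun ω : ℕ → S × A => l (ω t) :=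
    fun t => hl.comp (measurable_pi_apply t)
  have hTt : ∀ t, Measurable fun ω : ℕ → S × A => ∫⁻ s, v s ∂(T (ω t)) :=
    fun t => hv.lintegral_kernel.comp (measurable_pi_apply t)
  have hstep : ∀ t, ∫⁻ ω, v (ω t).1 ∂(pathLaw T γ x₀) ≤ ∫⁻ ω, l (ω t) ∂(pathLaw T γ x₀) +
      b * ∫⁻ ω, v (ω (t + 1)).1 ∂(pathLaw T γ x₀) := fun t => by
    rw [lintegral_pathLaw_succ_fst T γ x₀ t hv, ← lintegral_const_mul _ (hTt t), ← lintegral_add_left (hlt t)]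
    exact lintegral_mono_ae (h t)
  have hN : ∀ N, v x₀ ≤ ∑ t ∈ Finset.range N, b ^ t * ∫⁻ ω, l (ω t) ∂(pathLaw T γ x₀) +
      b ^ N * ∫⁻ ω, v (ω N).1 ∂(pathLaw T γ x₀) := fun N => by
    induction N with
    | zero =>
      have := lintegral_pathLaw_zero T γ x₀ (g := fun p => v p.1) (hv.comp measurable_fst)
      simp [this]
    | succ N ih =>
      refine ih.trans ?_
      rw [Finset.sum_range_succ, add_assoc, pow_succ, mul_assoc, ← mul_add]
      gcongr
      exact hstep N
  rw [lintegral_tsum fun t => ((hlt t).const_mul _).aemeasurable]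
  simp_rw [fun t => lintegral_const_mul (μ := pathLaw T γ x₀) (b ^ t) (hlt t)]
  have hlim : Filter.Tendsto (fun N : ℕ => (∑' t, b ^ t * ∫⁻ ω, l (ω t) ∂(pathLaw T γ x₀)) +
      b ^ N * K) Filter.atTop
      (nhds ((∑' t, b ^ t * ∫⁻ ω, l (ω t) ∂(pathLaw T γ x₀)) + 0 * K)) :=
    tendsto_const_nhds.add (ENNReal.Tendsto.mul_const
      (ENNReal.tendsto_pow_atTop_nhds_zero_of_lt_one hb) (Or.inr hK))
  rw [zero_mul, add_zero] at hlim
  refine ge_of_tendsto' hlim fun N => (hN N).trans ?_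
  gcongr
  · exact ENNReal.sum_le_tsum _
  · calc ∫⁻ ω, v (ω N).1 ∂(pathLaw T γ x₀) ≤ ∫⁻ _, K ∂(pathLaw T γ x₀) :=
        lintegral_mono fun ω => hvK _
      _ = K := by simp

/-- The reverse unrolling; the remainder is nonnegative and is simply dropped, so `v` need not be
bounded. -/
lemma lintegral_tsum_le_of_supersolution (hv : Measurable v) (hl : Measurable l)
    (γ : AdmissiblePolicy S A) (x₀ : S)
    (h : ∀ t, ∀ᵐ ω ∂(pathLaw T γ x₀), l (ω t) + b * ∫⁻ s, v s ∂(T (ω t)) ≤ v (ω t).1) :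
    ∫⁻ ω, ∑' t, b ^ t * l (ω t) ∂(pathLaw T γ x₀) ≤ v x₀ := by
  have hlt : ∀ t, Measurable fun ω : ℕ → S × A => l (ω t) :=
    fun t => hl.comp (measurable_pi_apply t)
  have hTt : ∀ t, Measurable fun ω : ℕ → S × A => ∫⁻ s, v s ∂(T (ω t)) :=
    fun t => hv.lintegral_kernel.comp (measurable_pi_apply t)
  have hstep : ∀ t, ∫⁻ ω, l (ω t) ∂(pathLaw T γ x₀) +
      b * ∫⁻ ω, v (ω (t + 1)).1 ∂(pathLaw T γ x₀) ≤ ∫⁻ ω, v (ω t).1 ∂(pathLaw T γ x₀) :=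
    fun t => by
    rw [lintegral_pathLaw_succ_fst T γ x₀ t hv, ← lintegral_const_mul _ (hTt t), ← lintegral_add_left (hlt t)]
    exact lintegral_mono_ae (h t)
  have hN : ∀ N, ∑ t ∈ Finset.range N, b ^ t * ∫⁻ ω, l (ω t) ∂(pathLaw T γ x₀) +
      b ^ N * ∫⁻ ω, v (ω N).1 ∂(pathLaw T γ x₀) ≤ v x₀ := fun N => by
    induction N with
    | zero =>
      have := lintegral_pathLaw_zero T γ x₀ (g := fun p => v p.1) (hv.comp measurable_fst)
      simp [this]
    | succ N ih =>
      refine le_trans ?_ ih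
      rw [Finset.sum_range_succ, add_assoc, pow_succ, mul_assoc, ← mul_add]
      gcongr
      exact hstep N
  rw [lintegral_tsum fun t => ((hlt t).const_mul _).aemeasurable]
  simp_rw [fun t => lintegral_const_mul (μ := pathLaw T γ x₀) (b ^ t) (hlt t)]
  rw [ENNReal.tsum_eq_iSup_nat]
  exact iSup_le fun N => le_self_add.trans (hN N)

/-! ### The optimal value function -/

lemma discountedCost_eq_toReal {c : S × A → ℝ} (hc : Measurable c) (hc0 : ∀ p, 0 ≤ c p)
    {K : ℝ} (hcK : ∀ p, c p ≤ K) {β : ℝ} (hβ0 : 0 ≤ β) (hβ1 : β < 1) (x₀ : S)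
    (γ : AdmissiblePolicy S A) :
    discountedCost T c β x₀ γ = (∫⁻ ω, ∑' t, ENNReal.ofReal β ^ t * ENNReal.ofReal (c (ω t))
      ∂(pathLaw T γ x₀)).toReal := by
  have hs : ∀ ω : ℕ → S × A, Summable fun t => β ^ t * c (ω t) := fun ω =>
    Summable.of_nonneg_of_le (fun t => mul_nonneg (pow_nonneg hβ0 t) (hc0 _))
      (fun t => mul_le_mul_of_nonneg_left (hcK _) (pow_nonneg hβ0 t))
      ((summable_geometric_of_lt_one hβ0 hβ1).mul_right K)
  have he : ∀ ω : ℕ → S × A, ∑' t, ENNReal.ofReal β ^ t * ENNReal.ofReal (c (ω t)) =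
      ENNReal.ofReal (∑' t, β ^ t * c (ω t)) := fun ω => by
    rw [ENNReal.ofReal_tsum_of_nonneg (fun t => mul_nonneg (pow_nonneg hβ0 t) (hc0 _)) (hs ω)]
    exact tsum_congr fun t => by
      rw [ENNReal.ofReal_mul (pow_nonneg hβ0 t), ENNReal.ofReal_pow hβ0]
  have hm : Measurable fun ω : ℕ → S × A => ∑' t, ENNReal.ofReal β ^ t * ENNReal.ofReal (c (ω t)) :=
    Measurable.tsum fun t =>
      ((hc.comp (measurable_pi_apply t)).ennreal_ofReal).const_mul _
  have hr : ∀ ω : ℕ → S × A, ∑' t, β ^ t * c (ω t) =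
      (∑' t, ENNReal.ofReal β ^ t * ENNReal.ofReal (c (ω t))).toReal := fun ω => by
    rw [he, ENNReal.toReal_ofReal (tsum_nonneg fun t => mul_nonneg (pow_nonneg hβ0 t) (hc0 _))]
  rw [discountedCost, ← integral_toReal hm.aemeasurable
    (Filter.Eventually.of_forall fun ω => by rw [he]; exact ENNReal.ofReal_lt_top)]
  exact integral_congr_ae (Filter.Eventually.of_forall hr)

/-- The optimal value function of a problem with finitely many actions and bounded nonnegative
cost is measurable, bounded, and solves the dynamic programming equation. -/
theorem optimalValue_spec [Finite A] [Nonempty A] [DiscreteMeasurableSpace A] {c : S × A → ℝ}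
    (hc : Measurable c) (hc0 : ∀ p, 0 ≤ c p) {K : ℝ} (hcK : ∀ p, c p ≤ K)
    {β : ℝ} (hβ0 : 0 ≤ β) (hβ1 : β < 1) :
    Measurable (optimalValue T c β) ∧
    (∀ x, 0 ≤ optimalValue T c β x) ∧
    (∀ x, optimalValue T c β x ≤ K / (1 - β)) ∧
    ∀ x, optimalValue T c β x = ⨅ u : A, (c (x, u) + β * ∫ s, optimalValue T c β s ∂(T (x, u))) := by
  rcases isEmpty_or_nonempty S with hS | ⟨⟨s₀⟩⟩
  · exact ⟨measurable_of_empty _, fun x => hS.elim x, fun x => hS.elim x, fun x => hS.elim x⟩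
  have h1β : 0 < 1 - β := by linarith
  have hK0 : 0 ≤ K := (hc0 (s₀, Classical.arbitrary A)).trans (hcK _)
  have hV0 : 0 ≤ K / (1 - β) := by positivity
  have hl : Measurable fun p => ENNReal.ofReal (c p) := hc.ennreal_ofReal
  -- `K / (1 - β)` is the fixed point of `r ↦ K + β r`, hence a constant supersolution.
  obtain ⟨w, hw, hwK, hfix⟩ := exists_bellman_fixedPoint T (b := ENNReal.ofReal β) hl
    (K := ENNReal.ofReal (K / (1 - β))) (fun p => by
      rw [← ENNReal.ofReal_mul hβ0, ← ENNReal.ofReal_add (hc0 p) (by positivity)]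
      refine ENNReal.ofReal_le_ofReal ?_
      have : K + β * (K / (1 - β)) = K / (1 - β) := by field_simp; ring
      linarith [hcK p])
  have hwt : ∀ x, w x ≠ ∞ := fun x => ((hwK x).trans_lt ENNReal.ofReal_lt_top).ne
  have hle : ∀ x u, w x ≤ ENNReal.ofReal (c (x, u)) + ENNReal.ofReal β * ∫⁻ s, w s ∂(T (x, u)) :=
    fun x u => (congrFun hfix x).symm.le.trans (iInf_le _ u)
  have hb1 : ENNReal.ofReal β < 1 := by simpa using hβ1
  have hcost : ∀ x₀ γ, ∫⁻ ω, ∑' t, ENNReal.ofReal β ^ t * ENNReal.ofReal (c (ω t))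
      ∂(pathLaw T γ x₀) ≠ ∞ := fun x₀ γ => by
    refine ((lintegral_tsum_le_of_supersolution T (v := fun _ => ENNReal.ofReal (K / (1 - β)))
      measurable_const hl γ x₀ fun t => Filter.Eventually.of_forall fun ω => ?_).trans_lt
      ENNReal.ofReal_lt_top).ne
    rw [lintegral_const, measure_univ, mul_one, ← ENNReal.ofReal_mul hβ0,
      ← ENNReal.ofReal_add (hc0 _) (by positivity)]
    refine ENNReal.ofReal_le_ofReal ?_
    have : K + β * (K / (1 - β)) = K / (1 - β) := by field_simp; ring
    linarith [hcK (ω t)]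
  obtain ⟨f, hf, hfm⟩ := exists_measurable_eq_iInf (g := fun p : S × A =>
    ENNReal.ofReal (c p) + ENNReal.ofReal β * ∫⁻ s, w s ∂(T p))
    (hl.add (hw.lintegral_kernel.const_mul _))
  have hopt : optimalValue T c β = fun x => (w x).toReal := by
    funext x₀
    -- `w` is below every one-action Bellman expression, so it bounds the cost of every admissible
    -- policy from below; the greedy control `f` gives equality.
    have hlow : ∀ γ, (w x₀).toReal ≤ discountedCost T c β x₀ γ := fun γ => by
      rw [discountedCost_eq_toReal T hc hc0 hcK hβ0 hβ1]
      exact ENNReal.toReal_mono (hcost x₀ γ) (le_lintegral_tsum_of_subsolution T hw hl hb1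
        ENNReal.ofReal_ne_top hwK γ x₀ fun t => Filter.Eventually.of_forall fun ω => hle _ _)
    refine le_antisymm ?_ ?_
    · refine (ciInf_le ⟨(w x₀).toReal, by rintro _ ⟨γ, rfl⟩; exact hlow γ⟩
        (AdmissiblePolicy.stationary f hf)).trans ?_
      rw [discountedCost_eq_toReal T hc hc0 hcK hβ0 hβ1]
      refine ENNReal.toReal_mono (hwt x₀) (lintegral_tsum_le_of_supersolution T hw hl _ x₀
        fun t => ?_)
      filter_upwards [stationary_ae_eq T hf x₀ t] with ω hω
      have : ω t = ((ω t).1, f (ω t).1) := Prod.ext rfl hω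
      rw [this]
      exact ((hfm _).trans (congrFun hfix _)).le
    · have : Nonempty (AdmissiblePolicy S A) := ⟨AdmissiblePolicy.stationary f hf⟩
      exact le_ciInf hlow
  rw [hopt]
  refine ⟨hw.ennreal_toReal, fun x => ENNReal.toReal_nonneg, fun x => ?_, fun x => ?_⟩
  · exact ENNReal.toReal_le_of_le_ofReal hV0 (hwK x)
  · have hint : ∀ u, ∫⁻ s, w s ∂(T (x, u)) ≠ ∞ := fun u => by
      refine ((lintegral_mono hwK).trans_lt ?_).ne
      simp
    change (w x).toReal = _
    conv_lhs => rw [← hfix]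
    rw [bellman, ENNReal.toReal_iInf]
    · refine iInf_congr fun u => ?_
      rw [ENNReal.toReal_add ENNReal.ofReal_ne_top (ENNReal.mul_ne_top ENNReal.ofReal_ne_top
        (hint u)), ENNReal.toReal_mul, ENNReal.toReal_ofReal (hc0 _), ENNReal.toReal_ofReal hβ0,
        integral_toReal hw.aemeasurable
          (Filter.Eventually.of_forall fun s => (hwt s).lt_top)]
    · exact fun u => ENNReal.add_ne_top.2 ⟨ENNReal.ofReal_ne_top,
        ENNReal.mul_ne_top ENNReal.ofReal_ne_top (hint u)⟩

end General

/-! ### Total variation and integrals of functions of the bin -/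

lemma continuous_l1norm {n : ℕ} : Continuous (l1norm (n := n)) := by
  unfold l1norm; fun_prop

/-- The differences are bounded by `1`, so the real supremum is a genuine one and not the default
value of an unbounded family. -/
lemma abs_measureReal_sub_le_tvDist {S : Type*} [MeasurableSpace S] (μ ν : Measure S)
    [IsProbabilityMeasure μ] [IsProbabilityMeasure ν] {B : Set S} (hB : MeasurableSet B) :
    |μ.real B - ν.real B| ≤ tvDist μ ν := by
  refine le_ciSup (f := fun B : {B : Set S // MeasurableSet B} => |μ.real B - ν.real B|)
    ⟨1, ?_⟩ ⟨B, hB⟩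
  rintro _ ⟨B, rfl⟩
  exact abs_sub_le_of_nonneg_of_le measureReal_nonneg measureReal_le_one measureReal_nonneg
    measureReal_le_one

namespace Quantization

variable {S : Type*} [MeasurableSpace S] {M : ℕ} (Q : Quantization S M)

lemma mem_bin_index (x : S) : x ∈ Q.bin (Q.index x) := (Q.exists_mem_bin x).choose_spec

lemma index_eq_iff {x : S} {i : Fin M} : Q.index x = i ↔ x ∈ Q.bin i := by
  refine ⟨fun h => h ▸ Q.mem_bin_index x, fun h => ?_⟩
  by_contra hne
  exact Set.disjoint_left.1 (Q.disjoint_bin _ _ hne) (Q.mem_bin_index x) h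

lemma index_preimage_singleton (i : Fin M) : Q.index ⁻¹' {i} = Q.bin i :=
  Set.ext fun _ => Q.index_eq_iff

lemma measurable_index : Measurable Q.index :=
  measurable_to_countable' fun i => by
    rw [index_preimage_singleton]; exact Q.measurableSet_bin i

instance (i : Fin M) : IsProbabilityMeasure ((Q.binMeasure i).restrict (Q.bin i)) := by
  have := Q.isProbabilityMeasure_weight
  refine ⟨?_⟩
  rw [Measure.restrict_apply_univ]
  exact cond_apply_self (Q.weight_pos i).ne' (measure_ne_top _ _)

lemma integral_comp_index (μ : Measure S) [IsFiniteMeasure μ] (v : Fin M → ℝ) :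
    ∫ x, v (Q.index x) ∂μ = ∑ j, v j * μ.real (Q.bin j) := by
  rw [← integral_map Q.measurable_index.aemeasurable
    (Measurable.of_discrete (f := v)).aestronglyMeasurable,
    integral_fintype Integrable.of_finite]
  refine Finset.sum_congr rfl fun j _ => ?_
  rw [map_measureReal_apply Q.measurable_index (measurableSet_singleton j),
    index_preimage_singleton, smul_eq_mul, mul_comm]

/-- A function of the bin with values in `[0, V]` has integrals that differ by at most `V` times
the total variation distance. -/
lemma abs_integral_comp_index_sub_le (μ ν : Measure S) [IsProbabilityMeasure μ]
    [IsProbabilityMeasure ν] {v : Fin M → ℝ} {V : ℝ} (hv0 : ∀ j, 0 ≤ v j) (hvV : ∀ j, v j ≤ V)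
    (hV : 0 ≤ V) :
    |∫ x, v (Q.index x) ∂μ - ∫ x, v (Q.index x) ∂ν| ≤ V * tvDist μ ν := by
  have key : ∀ (μ ν : Measure S) [IsProbabilityMeasure μ] [IsProbabilityMeasure ν],
      ∃ B, MeasurableSet B ∧ ∫ x, v (Q.index x) ∂μ - ∫ x, v (Q.index x) ∂ν ≤
        V * |μ.real B - ν.real B| := by
    intro μ ν _ _
    -- The extremal set is the union of the bins where `μ` dominates `ν`. The other bins contribute
    -- nonpositively since `v ≥ 0`, which gives the constant `V` rather than `2 * V`.
    let s : Finset (Fin M) := {j | ν.real (Q.bin j) ≤ μ.real (Q.bin j)}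
    have hd : (s : Set (Fin M)).PairwiseDisjoint Q.bin := fun i _ j _ h => Q.disjoint_bin i j h
    refine ⟨⋃ j ∈ s, Q.bin j, s.measurableSet_biUnion fun j _ => Q.measurableSet_bin j, ?_⟩
    rw [Q.integral_comp_index, Q.integral_comp_index, ← Finset.sum_sub_distrib,
      measureReal_biUnion_finset hd fun j _ => Q.measurableSet_bin j,
      measureReal_biUnion_finset hd fun j _ => Q.measurableSet_bin j, ← Finset.sum_sub_distrib]
    calc ∑ j, (v j * μ.real (Q.bin j) - v j * ν.real (Q.bin j))
        ≤ ∑ j, if j ∈ s then V * (μ.real (Q.bin j) - ν.real (Q.bin j)) else 0 := by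
          refine Finset.sum_le_sum fun j _ => ?_
          rw [← mul_sub]
          split_ifs with hj
          · exact mul_le_mul_of_nonneg_right (hvV j) (sub_nonneg.2 (by simpa [s] using hj))
          · exact mul_nonpos_of_nonneg_of_nonpos (hv0 j)
              (sub_nonpos.2 (by simpa [s] using hj : _ < _).le)
      _ = V * ∑ j ∈ s, (μ.real (Q.bin j) - ν.real (Q.bin j)) := by
          rw [Finset.mul_sum, Finset.sum_ite_mem, Finset.univ_inter]
      _ ≤ _ := mul_le_mul_of_nonneg_left (le_abs_self _) hV
  obtain ⟨B, hB, h1⟩ := key μ ν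
  obtain ⟨B', hB', h2⟩ := key ν μ
  rw [abs_sub_comm] at h2
  refine abs_sub_le_iff.2 ⟨h1.trans ?_, h2.trans ?_⟩
  · exact mul_le_mul_of_nonneg_left (abs_measureReal_sub_le_tvDist μ ν hB) hV
  · exact mul_le_mul_of_nonneg_left (abs_measureReal_sub_le_tvDist μ ν hB') hV

/-! ### The finite model -/

lemma finiteCost_nonneg {A : Type*} {c : S × A → ℝ} (hc0 : ∀ p, 0 ≤ c p) (p : Fin M × A) :
    0 ≤ Q.finiteCost c p :=
  integral_nonneg fun _ => hc0 _

variable {A : Type*} [MeasurableSpace A]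

lemma integrable_section {c : S × A → ℝ} (hc : Measurable c) {K : ℝ} (hcK : ∀ p, |c p| ≤ K)
    (u : A) (μ : Measure S) [IsFiniteMeasure μ] : Integrable (fun x => c (x, u)) μ :=
  Integrable.of_bound (hc.comp measurable_prodMk_right).aestronglyMeasurable K
    (Filter.Eventually.of_forall fun _ => hcK _)

lemma finiteCost_le {c : S × A → ℝ} (hc : Measurable c) {K : ℝ} (hcK : ∀ p, |c p| ≤ K)
    (p : Fin M × A) : Q.finiteCost c p ≤ K := by
  calc Q.finiteCost c p ≤ ∫ _, K ∂((Q.binMeasure p.1).restrict (Q.bin p.1)) :=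
        integral_mono (integrable_section hc hcK _ _) (integrable_const _)
          fun _ => (le_abs_self _).trans (hcK _)
    _ = K := by simp

variable (T : Kernel (S × A) S) [IsMarkovKernel T]

lemma finiteProb_ne_top (p : Fin M × A) (j : Fin M) : Q.finiteProb T p j ≠ ∞ := by
  refine ((lintegral_mono fun x => prob_le_one).trans_lt
    (b := ∫⁻ _, 1 ∂((Q.binMeasure p.1).restrict (Q.bin p.1))) ?_).ne
  simp

lemma integral_finiteKernel [Finite A] [DiscreteMeasurableSpace A] (p : Fin M × A)
    (v : Fin M → ℝ) :
    ∫ j, v j ∂(Q.finiteKernel T p) = ∑ j, v j * (Q.finiteProb T p j).toReal := by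
  change ∫ j, v j ∂(∑ j, Q.finiteProb T p j • Measure.dirac j : Measure (Fin M)) = _
  rw [integral_finsetSum_measure]
  · refine Finset.sum_congr rfl fun j _ => ?_
    rw [integral_smul_measure, integral_dirac, smul_eq_mul, mul_comm]
  · exact fun j _ => (integrable_dirac (by simp)).smul_measure (Q.finiteProb_ne_top T p j)

lemma sum_finiteProb [Finite A] [DiscreteMeasurableSpace A] (p : Fin M × A) :
    ∑ j, (Q.finiteProb T p j).toReal = 1 := by
  simpa using (Q.integral_finiteKernel T p (fun _ => 1)).symm

/-- Expresses the continuation value of the finite model as a bin average of the original one, so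
that both equations can be compared on the same space. -/
lemma sum_mul_finiteProb (p : Fin M × A) (v : Fin M → ℝ) :
    ∑ j, v j * (Q.finiteProb T p j).toReal =
      ∫ x in Q.bin p.1, ∫ z, v (Q.index z) ∂(T (x, p.2)) ∂(Q.binMeasure p.1) := by
  have hm : ∀ j, Measurable fun x => T (x, p.2) (Q.bin j) := fun j =>
    (Kernel.measurable_coe T (Q.measurableSet_bin j)).comp measurable_prodMk_right
  simp_rw [Q.integral_comp_index]
  rw [integral_finsetSum]
  · refine Finset.sum_congr rfl fun j _ => ?_
    rw [integral_const_mul, finiteProb, ← integral_toReal (hm j).aemeasurable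
      (Filter.Eventually.of_forall fun x => measure_lt_top _ _)]
    rfl
  · exact fun j _ => (Integrable.of_bound (hm j).ennreal_toReal.aestronglyMeasurable 1
      (Filter.Eventually.of_forall fun x => by
        rw [Real.norm_of_nonneg ENNReal.toReal_nonneg]
        exact measureReal_le_one)).const_mul _

lemma measurable_approxValue [Finite A] [DiscreteMeasurableSpace A] (c : S × A → ℝ) (β : ℝ) :
    Measurable (Q.approxValue T c β) :=
  (Measurable.of_discrete (f := Q.finiteValue T c β)).comp Q.measurable_index

section FiniteValue

variable [Finite A] [Nonempty A] [DiscreteMeasurableSpace A] {c : S × A → ℝ} {K β : ℝ}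

lemma finiteValue_spec (hc : Measurable c) (hc0 : ∀ p, 0 ≤ c p) (hcK : ∀ p, |c p| ≤ K)
    (hβ0 : 0 ≤ β) (hβ1 : β < 1) :
    (∀ i, 0 ≤ Q.finiteValue T c β i) ∧ (∀ i, Q.finiteValue T c β i ≤ K / (1 - β)) ∧
      Q.SolvesDPE T c β (Q.finiteValue T c β) := by
  obtain ⟨-, h0, h1, h2⟩ := optimalValue_spec (Q.finiteKernel T) (c := Q.finiteCost c)
    Measurable.of_discrete (Q.finiteCost_nonneg hc0) (Q.finiteCost_le hc hcK) hβ0 hβ1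
  refine ⟨h0, h1, fun i => (h2 i).trans ?_⟩
  simp_rw [Q.integral_finiteKernel T]
  rfl

/-- The finite Bellman operator contracts the sup norm by the factor `β < 1`, since its transition
probabilities sum to `1`. -/
lemma SolvesDPE.unique {Q : Quantization S M} {T : Kernel (S × A) S} [IsMarkovKernel T]
    (hβ0 : 0 ≤ β) (hβ1 : β < 1) {v w : Fin M → ℝ}
    (hv : Q.SolvesDPE T c β v) (hw : Q.SolvesDPE T c β w) : v = w := by
  have hle : ∀ i, |v i - w i| ≤ β * ‖v - w‖ := fun i => by
    rw [hv i, hw i]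
    obtain ⟨u, hu⟩ := exists_abs_iInf_sub_iInf_le
      (fun u : A => Q.finiteCost c (i, u) + β * ∑ j, v j * (Q.finiteProb T (i, u) j).toReal)
      (fun u : A => Q.finiteCost c (i, u) + β * ∑ j, w j * (Q.finiteProb T (i, u) j).toReal)
    refine hu.trans ?_
    rw [add_sub_add_left_eq_sub, ← mul_sub, abs_mul, abs_of_nonneg hβ0, ← Finset.sum_sub_distrib]
    refine mul_le_mul_of_nonneg_left ?_ hβ0
    calc |∑ j, (v j * (Q.finiteProb T (i, u) j).toReal - w j * (Q.finiteProb T (i, u) j).toReal)|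
        ≤ ∑ j, ‖v - w‖ * (Q.finiteProb T (i, u) j).toReal := by
          refine (Finset.abs_sum_le_sum_abs _ _).trans (Finset.sum_le_sum fun j _ => ?_)
          rw [← sub_mul, abs_mul, abs_of_nonneg ENNReal.toReal_nonneg]
          exact mul_le_mul_of_nonneg_right (norm_le_pi_norm (v - w) j) ENNReal.toReal_nonneg
      _ = ‖v - w‖ := by rw [← Finset.mul_sum, Q.sum_finiteProb, mul_one]
  have hn : ‖v - w‖ ≤ β * ‖v - w‖ :=
    (pi_norm_le_iff_of_nonneg (mul_nonneg hβ0 (norm_nonneg _))).2 hle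
  have : ‖v - w‖ = 0 := by nlinarith [norm_nonneg (v - w)]
  exact sub_eq_zero.1 (norm_eq_zero.1 this)

lemma measurable_ofReal_abs_sub (hc : Measurable c) (hc0 : ∀ p, 0 ≤ c p) (hcK : ∀ p, |c p| ≤ K)
    (hβ0 : 0 ≤ β) (hβ1 : β < 1) :
    Measurable fun z => ENNReal.ofReal |Q.approxValue T c β z - optimalValue T c β z| :=
  ((Q.measurable_approxValue T c β).sub (optimalValue_spec T hc hc0
    (fun p => (le_abs_self _).trans (hcK p)) hβ0 hβ1).1).norm.ennreal_ofReal

end FiniteValue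

/-! ### The error bound -/

section Loss

variable {n : ℕ} {X : Set (Fin n → ℝ)}

lemma measurable_ofReal_l1norm_sub :
    Measurable fun p : X × X => ENNReal.ofReal (l1norm (p.1.1 - p.2.1)) := by
  have h : Continuous fun p : X × X => p.1.1 - p.2.1 := by fun_prop
  exact (continuous_l1norm.comp h).measurable.ennreal_ofReal

lemma measurable_ofReal_l1norm_sub_left (x : X) :
    Measurable fun x' : X => ENNReal.ofReal (l1norm (x.1 - x'.1)) := by
  have h : Continuous fun x' : X => x.1 - x'.1 := by fun_prop
  exact (continuous_l1norm.comp h).measurable.ennreal_ofReal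

lemma measurable_loss (Q : Quantization X M) : Measurable Q.loss := by
  have hF : ∀ i, Measurable fun x : X => ∫⁻ x' in Q.bin i,
      ENNReal.ofReal (l1norm (x.1 - x'.1)) ∂(Q.binMeasure i) := fun i =>
    Measurable.lintegral_prod_right' measurable_ofReal_l1norm_sub
  have hG : Measurable fun p : X × Fin M => ∫⁻ x' in Q.bin p.2,
      ENNReal.ofReal (l1norm (p.1.1 - x'.1)) ∂(Q.binMeasure p.2) :=
    measurable_from_prod_countable_left hF
  have hx : Measurable fun x : X => (x, Q.index x) := measurable_id.prodMk Q.measurable_index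
  have h := hG.comp hx
  simp only [Function.comp_def] at h
  exact h

/-- Lipschitz bound for `x ↦ c(x, u) + β ∫ v(q(z)) T(dz | x, u)`. -/
lemma abs_cost_add_integral_sub_le {U : Type*} [MeasurableSpace U]
    (T : Kernel (X × U) X) [IsMarkovKernel T] {c : X × U → ℝ}
    {K β αc αT : ℝ} (hβ0 : 0 ≤ β) (hβ1 : β < 1) (hK : 0 ≤ K)
    (hcLip : ∀ (x x' : X) (u : U), |c (x, u) - c (x', u)| ≤ αc * l1norm (x.1 - x'.1))
    (hTLip : ∀ (x x' : X) (u : U), tvDist (T (x, u)) (T (x', u)) ≤ αT * l1norm (x.1 - x'.1))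
    (Q : Quantization X M) {v : Fin M → ℝ} (hv0 : ∀ j, 0 ≤ v j)
    (hvV : ∀ j, v j ≤ K / (1 - β)) (x x' : X) (u : U) :
    |c (x', u) + β * ∫ z, v (Q.index z) ∂(T (x', u)) -
        (c (x, u) + β * ∫ z, v (Q.index z) ∂(T (x, u)))| ≤
      (αc + β * αT * K / (1 - β)) * l1norm (x.1 - x'.1) := by
  have h1β : 0 < 1 - β := by linarith
  have h1 := hcLip x x' u
  -- The factor `K / (1 - β)` bounds `v`; multiplied by `β` and the Lipschitz constant of `T` it
  -- gives the second part of the constant.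
  have h2 := (Q.abs_integral_comp_index_sub_le (T (x, u)) (T (x', u)) hv0 hvV
    (by positivity)).trans (mul_le_mul_of_nonneg_left (hTLip x x' u) (by positivity))
  rw [abs_sub_comm] at h1 h2
  calc |c (x', u) + β * ∫ z, v (Q.index z) ∂(T (x', u)) -
          (c (x, u) + β * ∫ z, v (Q.index z) ∂(T (x, u)))|
      = |(c (x', u) - c (x, u)) + β * (∫ z, v (Q.index z) ∂(T (x', u)) -
          ∫ z, v (Q.index z) ∂(T (x, u)))| := by congr 1; ring
    _ ≤ |c (x', u) - c (x, u)| + β * |∫ z, v (Q.index z) ∂(T (x', u)) -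
          ∫ z, v (Q.index z) ∂(T (x, u))| := by
        refine (abs_add_le _ _).trans ?_
        rw [abs_mul, abs_of_nonneg hβ0]
    _ ≤ αc * l1norm (x.1 - x'.1) + β * (K / (1 - β) * (αT * l1norm (x.1 - x'.1))) :=
        add_le_add h1 (mul_le_mul_of_nonneg_left h2 hβ0)
    _ = (αc + β * αT * K / (1 - β)) * l1norm (x.1 - x'.1) := by ring

/-- The approximation error is a subsolution of the dynamic programming equation with running
cost proportional to the loss. -/
lemma ofReal_abs_approxValue_sub_le {U : Type*} [MeasurableSpace U] [Finite U] [Nonempty U]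
    [DiscreteMeasurableSpace U] (T : Kernel (X × U) X) [IsMarkovKernel T] {c : X × U → ℝ}
    {K β αc αT : ℝ} (hc : Measurable c) (hc0 : ∀ p, 0 ≤ c p) (hcK : ∀ p, |c p| ≤ K)
    (hβ0 : 0 ≤ β) (hβ1 : β < 1) (hαc : 0 ≤ αc) (hαT : 0 ≤ αT) (hK : 0 ≤ K)
    (hcLip : ∀ (x x' : X) (u : U), |c (x, u) - c (x', u)| ≤ αc * l1norm (x.1 - x'.1))
    (hTLip : ∀ (x x' : X) (u : U), tvDist (T (x, u)) (T (x', u)) ≤ αT * l1norm (x.1 - x'.1))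
    (Q : Quantization X M) (x : X) :
    ENNReal.ofReal |Q.approxValue T c β x - optimalValue T c β x| ≤
      ENNReal.ofReal (αc + β * αT * K / (1 - β)) * Q.loss x +
        ENNReal.ofReal β * ⨆ u : U,
          ∫⁻ z, ENNReal.ofReal |Q.approxValue T c β z - optimalValue T c β z| ∂(T (x, u)) := by
  have h1β : 0 < 1 - β := by linarith
  obtain ⟨hv0, hvV, hdpe⟩ := Q.finiteValue_spec T hc hc0 hcK hβ0 hβ1
  obtain ⟨hJm, hJ0, hJV, hJ⟩ := optimalValue_spec T hc hc0
    (fun p => (le_abs_self _).trans (hcK p)) hβ0 hβ1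
  set v := Q.finiteValue T c β with hv
  set J := optimalValue T c β with hJdef
  set i := Q.index x with hi
  have hvm : Measurable fun z => v (Q.index z) :=
    (Measurable.of_discrete (f := v)).comp Q.measurable_index
  have hvb : ∀ z, ‖v (Q.index z)‖ ≤ K / (1 - β) := fun z => by
    rw [Real.norm_of_nonneg (hv0 _)]; exact hvV _
  have hJb : ∀ z, ‖J z‖ ≤ K / (1 - β) := fun z => by
    rw [Real.norm_of_nonneg (hJ0 _)]; exact hJV _
  have hvi : ∀ p, Integrable (fun z => v (Q.index z)) (T p) := fun p =>
    Integrable.of_bound hvm.aestronglyMeasurable _ (Filter.Eventually.of_forall hvb)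
  have hJi : ∀ p, Integrable J (T p) := fun p =>
    Integrable.of_bound hJm.aestronglyMeasurable _ (Filter.Eventually.of_forall hJb)
  have hTv : Measurable fun p : X × U => ∫ z, v (Q.index z) ∂(T p) :=
    (hvm.stronglyMeasurable.integral_kernel (κ := T)).measurable
  have hTvb : ∀ p, |∫ z, v (Q.index z) ∂(T p)| ≤ K / (1 - β) := fun p => by
    simpa using norm_integral_le_of_norm_le_const (μ := T p) (Filter.Eventually.of_forall hvb)
  have hlhs : Q.approxValue T c β x - J x =
      (⨅ u, ∫ x' in Q.bin i, (c (x', u) + β * ∫ z, v (Q.index z) ∂(T (x', u)))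
        ∂(Q.binMeasure i)) - ⨅ u, (c (x, u) + β * ∫ z, J z ∂(T (x, u))) := by
    rw [← hJ x, approxValue, ← hv, ← hi, hdpe i]
    congr 1
    refine iInf_congr fun u => ?_
    rw [integral_add (integrable_section hc hcK u _)
      ((integrable_section hTv hTvb u _).const_mul _), integral_const_mul,
      Q.sum_mul_finiteProb T (i, u) v]
    rfl
  rw [hlhs]
  obtain ⟨u, hu⟩ := exists_abs_iInf_sub_iInf_le
    (fun u => ∫ x' in Q.bin i, (c (x', u) + β * ∫ z, v (Q.index z) ∂(T (x', u)))
        ∂(Q.binMeasure i)) (fun u => c (x, u) + β * ∫ z, J z ∂(T (x, u)))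
  refine (ENNReal.ofReal_le_ofReal hu).trans ?_
  -- The inserted term uses `v ∘ q`, not `J`, under `T (x, u)`: the total variation estimate then
  -- concerns a function of the bin only.
  have hsplit : ∫ x' in Q.bin i, (c (x', u) + β * ∫ z, v (Q.index z) ∂(T (x', u)))
        ∂(Q.binMeasure i) - (c (x, u) + β * ∫ z, J z ∂(T (x, u))) =
      ∫ x' in Q.bin i, ((c (x', u) + β * ∫ z, v (Q.index z) ∂(T (x', u))) -
        (c (x, u) + β * ∫ z, v (Q.index z) ∂(T (x, u)))) ∂(Q.binMeasure i) +
      β * ∫ z, (v (Q.index z) - J z) ∂(T (x, u)) := by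
    have hint : Integrable (fun x' => c (x', u) + β * ∫ z, v (Q.index z) ∂(T (x', u)))
        ((Q.binMeasure i).restrict (Q.bin i)) :=
      (integrable_section hc hcK u _).add ((integrable_section hTv hTvb u _).const_mul _)
    rw [integral_sub hint (integrable_const _), integral_const,
      integral_sub (hvi _) (hJi _)]
    simp only [probReal_univ, one_smul]
    ring
  rw [hsplit]
  refine (ENNReal.ofReal_le_ofReal (abs_add_le _ _)).trans ?_
  rw [ENNReal.ofReal_add (abs_nonneg _) (abs_nonneg _), abs_mul, abs_of_nonneg hβ0,
    ENNReal.ofReal_mul hβ0]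
  have henorm : ∀ r : ℝ, ENNReal.ofReal |r| = ‖r‖ₑ := fun r =>
    (Real.enorm_eq_ofReal_abs r).symm
  refine add_le_add ?_ (mul_le_mul_right ?_ _)
  -- Working in `ℝ≥0∞` avoids any integrability of the distance, so `L(x) = ∞` is allowed.
  · rw [henorm, loss, ← lintegral_const_mul]
    · refine (enorm_integral_le_lintegral_enorm _).trans (lintegral_mono fun x' => ?_)
      dsimp only
      rw [← henorm, ← ENNReal.ofReal_mul (by positivity)]
      refine ENNReal.ofReal_le_ofReal ?_
      exact Q.abs_cost_add_integral_sub_le T hβ0 hβ1 hK hcLip hTLip hv0 hvV x x' u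
    · exact measurable_ofReal_l1norm_sub_left x
  · refine le_trans ?_ (le_iSup (fun u => ∫⁻ z, ENNReal.ofReal |Q.approxValue T c β z - J z|
      ∂(T (x, u))) u)
    rw [henorm]
    refine (enorm_integral_le_lintegral_enorm _).trans (lintegral_mono fun z => ?_)
    exact (henorm _).ge

end Loss

end Quantization

end QuantizedMDP

/-! ### The error bound for the quantized model -/

theorem mainTheorem1 {n M : ℕ} {X : Set (Fin n → ℝ)} (hX : MeasurableSet X)
    {U : Type*} [Finite U] [Nonempty U] [TopologicalSpace U] [DiscreteTopology U]
    [MeasurableSpace U] [DiscreteMeasurableSpace U]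
    (T : Kernel (X × U) X) [IsMarkovKernel T] (c : (X × U) →ᵇ ℝ) (β : ℝ)
    (hβ0 : 0 < β) (hβ1 : β < 1)
    (hc0 : ∀ p, 0 ≤ c p) (hT : WeakFeller T)
    (αc αT : ℝ) (hαc : 0 < αc) (hαT : 0 < αT)
    (hcLip : ∀ (x x' : X) (u : U), |c (x, u) - c (x', u)| ≤ αc * l1norm (x.1 - x'.1))
    (hTLip : ∀ (x x' : X) (u : U), tvDist (T (x, u)) (T (x', u)) ≤ αT * l1norm (x.1 - x'.1))
    (Q : Quantization X M) :
    -- the value function of the finite model is the unique solution of its DPE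
    (∀ v : Fin M → ℝ, Q.SolvesDPE T c β v ↔ v = Q.finiteValue T c β) ∧
    -- a maximizing measurable control function exists
    (∃ f : X → U, Measurable f ∧ Q.AttainsSup T c β f) ∧
    -- the error bound for the stationary policy given by any such control function
    (∀ (f : X → U) (hf : Measurable f), Q.AttainsSup T c β f → ∀ x₀ : X,
      ENNReal.ofReal |Q.approxValue T c β x₀ - optimalValue T c β x₀| ≤
        ENNReal.ofReal (αc + β * αT * ‖c‖ / (1 - β)) *
          expectedDiscounted T β Q.loss (AdmissiblePolicy.stationary f hf) x₀) ∧
    -- the error bound with the supremum over all stationary policies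
    (∀ x₀ : X,
      ENNReal.ofReal |Q.approxValue T c β x₀ - optimalValue T c β x₀| ≤
        ENNReal.ofReal (αc + β * αT * ‖c‖ / (1 - β)) *
          ⨆ f : {f : X → U // Measurable f},
            expectedDiscounted T β Q.loss (AdmissiblePolicy.stationary f.1 f.2) x₀) := by
  have hc : Measurable c := by
    refine measurable_from_prod_countable_left fun u => ?_
    exact (c.continuous.comp (by fun_prop : Continuous fun x : X => (x, u))).measurable
  have hcK : ∀ p, |c p| ≤ ‖c‖ := fun p => c.norm_coe_le_norm p
  have hD := Q.measurable_ofReal_abs_sub T hc hc0 hcK hβ0.le hβ1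
  have hex : ∃ f : X → U, Measurable f ∧ Q.AttainsSup T c β f :=
    exists_measurable_eq_iSup (g := fun p : X × U =>
      ∫⁻ z, ENNReal.ofReal |Q.approxValue T c β z - optimalValue T c β z| ∂(T p))
      hD.lintegral_kernel
  have hbound : ∀ (f : X → U) (hf : Measurable f), Q.AttainsSup T c β f → ∀ x₀ : X,
      ENNReal.ofReal |Q.approxValue T c β x₀ - optimalValue T c β x₀| ≤
        ENNReal.ofReal (αc + β * αT * ‖c‖ / (1 - β)) *
          expectedDiscounted T β Q.loss (AdmissiblePolicy.stationary f hf) x₀ := by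
    intro f hf hsup x₀
    obtain ⟨hv0, hvV, -⟩ := Q.finiteValue_spec T hc hc0 hcK hβ0.le hβ1
    obtain ⟨-, hJ0, hJV, -⟩ := optimalValue_spec T hc hc0
      (fun p => (le_abs_self _).trans (hcK p)) hβ0.le hβ1
    have hL : Measurable fun p : X × U => Q.loss p.1 := Q.measurable_loss.comp measurable_fst
    have key := le_lintegral_tsum_of_subsolution T hD
      (l := fun p => ENNReal.ofReal (αc + β * αT * ‖c‖ / (1 - β)) * Q.loss p.1)
      (hL.const_mul _) (b := ENNReal.ofReal β) (by simpa using hβ1)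
      (K := ENNReal.ofReal (‖c‖ / (1 - β))) ENNReal.ofReal_ne_top
      (fun x => ENNReal.ofReal_le_ofReal (abs_sub_le_of_nonneg_of_le (hv0 _) (hvV _)
        (hJ0 x) (hJV x))) (AdmissiblePolicy.stationary f hf) x₀ (fun t => by
        filter_upwards [stationary_ae_eq T hf x₀ t] with ω hω
        have hωt : ω t = ((ω t).1, f (ω t).1) := Prod.ext rfl hω
        rw [hωt]
        dsimp only
        rw [hsup]
        exact Quantization.ofReal_abs_approxValue_sub_le T hc hc0 hcK hβ0.le hβ1 hαc.le hαT.le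
          (norm_nonneg _) hcLip hTLip Q _)
    refine key.trans_eq ?_
    rw [expectedDiscounted, ← lintegral_const_mul]
    · refine lintegral_congr fun ω => ?_
      rw [← ENNReal.tsum_mul_left]
      refine tsum_congr fun t => ?_
      rw [ENNReal.ofReal_pow hβ0.le]
      ring
    · exact Measurable.tsum fun t => (hL.comp (measurable_pi_apply t)).const_mul _
  refine ⟨fun v => ⟨fun hv => ?_, ?_⟩, hex, hbound, fun x₀ => ?_⟩
  · exact hv.unique hβ0.le hβ1 (Q.finiteValue_spec T hc hc0 hcK hβ0.le hβ1).2.2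
  · rintro rfl
    exact (Q.finiteValue_spec T hc hc0 hcK hβ0.le hβ1).2.2
  -- A maximizing control is one of the stationary policies in the supremum.
  · obtain ⟨f, hf, hsup⟩ := hex
    refine (hbound f hf hsup x₀).trans (mul_le_mul_right ?_ _)
    exact le_iSup (fun f : {f : X → U // Measurable f} =>
      expectedDiscounted T β Q.loss (AdmissiblePolicy.stationary f.1 f.2) x₀) ⟨f, hf⟩
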